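/- **Setting.** Let $\mathbb K\in\{\mathbb R,\mathbb C\}$, let $X,Y$ be separable Hilbert spaces over $\mathbb K$ (inner products linear in the first argument), and let $L:\mathcal D(L)\subset X\to Y$ be an injective linear operator, with inverse $L^{-1}:\mathcal D(L^{-1})=\mathcal R(L)\to X$. An operator is called *bounded* if it is defined on the whole space and bounded there. Consider either of two cases. *Discrete case:* $w_1,\dots,w_s\in\mathcal D(L)$, weights $\gamma_j>0$, $S=\mathbb K^s$ with $(u,v)_S=\sum_j\gamma_ju_j\overline{v_j}$, and $$Kf=\sum_{j=1}^s\gamma_jf_jw_j,\qquad K^Yf=\sum_{j=1}^s\gamma_jf_j\,Lw_j .$$ *Continuous case:* $\mathcal O\subset\mathbb R^d$ open, $S=L^2(\mathcal O;\mathbb K^m)$, $w_1,\dots,w_m\in L^2(\mathcal O;X)$ with $w_j(t)\in\mathcal D(L)$ for a.e. $t$ and $Lw_j\in L^2(\mathcal O;Y)$, and $$Kf=\sum_{j=1}^m\int_{\mathcal O}f_j(t)w_j(t)\,dt,\qquad K^Yf=\sum_{j=1}^m\int_{\mathcal O}f_j(t)\,Lw_j(t)\,dt,$$ where it is assumed that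 $Kf\in\mathcal D(L)$ and $LKf=K^Yf$ for all $f\in S$ (in the discrete case this is automatic). Let $Kg=\sum_{k\ge1}\sigma_k(g,f_k)_S\,\varphi_k$ be a singular value decomposition with $\sigma_1\ge\sigma_2\ge\dots\ge0$, where the $f_k$ (in $S$) and the $\varphi_k$ (in $X$) with $\sigma_k>0$ are orthonormal, and let $s_X\in\{0,1,2,\dots\}\cup\{\infty\}$ be the number of positive $\sigma_k$. For finite $r\le s_X$ let $\Pi_r^X$ be the orthogonal projection of $X$ onto $\mathrm{span}\{\varphi_1,\dots,\varphi_r\}\subset\mathcal D(L)$ (so $\Pi_0^X=0$). The operator $L\Pi_r^XL^{-1}$ has domain $\mathcal R(L)$. "As $r$ increases" means $r\to\infty$ if $s_X=\infty$; if $s_X<\infty$, then $r$ runs up to $s_X$, and convergence means that the limit is attained at $r=s_X$. Terms with $\sigma_k=0$ in sums below are zero. **Theorem.** Assume that $s_X<\infty$, or that $L$ is bounded, or that $L^{-1}$ is bounded. 1. If $y=K^Yg$ for some $g\in S$, then $y\in\mathcal R(L)$, the series $\sum_k\sigma_k\,|(g,f_k)_S|\,\|L\varphi_k\|_Y$ converges,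 for every finite $r\le s_X$ $$\|y-L\Pi_r^XL^{-1}y\|_Y\le\sum_{k>r}\sigma_k\,|(g,f_k)_S|\,\|L\varphi_k\|_Y,$$ and $\|y-L\Pi_r^XL^{-1}y\|_Y\to0$ as $r$ increases. 2. Assume moreover that, in the case $s_X=\infty$, the operators $L\Pi_r^XL^{-1}$ are uniformly bounded, i.e. there is $C$ with $\|L\Pi_r^XL^{-1}y\|_Y\le C\|y\|_Y$ for all $r$ and all $y\in\mathcal R(L)$; and that all eigenvalues of $K^Y(K^Y)^*:Y\to Y$ (the POD eigenvalues of $\{Lw_j\}$) are nonzero. Then each $L\Pi_r^XL^{-1}$ has a unique extension to a bounded operator on $Y$, and, with the same notation for the extension, $L\Pi_r^XL^{-1}y\to y$ as $r$ increases for every $y\in Y$. If $s_X<\infty$, then $\mathcal R(L)=Y$, so no extension is needed. -/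

import Mathlib

open MeasureTheory Filter Topology

noncomputable section

/-! ### Partially defined linear operators -/

section Operators

variable {𝕜 : Type*} [RCLike 𝕜] {V W Z : Type*}
  [NormedAddCommGroup V] [NormedSpace 𝕜 V] [NormedAddCommGroup W] [NormedSpace 𝕜 W]
  [NormedAddCommGroup Z] [NormedSpace 𝕜 Z]

/-- A linear operator `T : D(T) ⊆ V → W` is *bounded* if it is defined on the whole space and
`‖T v‖ ≤ M ‖v‖` for some constant `M`. -/
def IsBoundedOperator (T : V →ₗ.[𝕜] W) : Prop :=
  T.domain = ⊤ ∧ ∃ M : ℝ, ∀ v : T.domain, ‖T v‖ ≤ M * ‖(v : V)‖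

/-- A linear operator `T : D(T) ⊆ V → W` is *invertible* if it is injective; its inverse
`T.inverse` then has domain `D(T⁻¹) = R(T)`. -/
def IsInvertibleOperator (T : V →ₗ.[𝕜] W) : Prop :=
  LinearMap.ker T.toFun = ⊥

/-- The value `T v`, set to `0` for `v ∉ D(T)`. -/
def operatorValue (T : V →ₗ.[𝕜] W) (v : V) : W :=
  open scoped Classical in if h : v ∈ T.domain then T ⟨v, h⟩ else 0

/-- The domain `{v ∈ D(A) : A v ∈ D(T)}` of the composition `T A`. -/
def compDomain (T : W →ₗ.[𝕜] Z) (A : V →ₗ.[𝕜] W) : Submodule 𝕜 V :=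
  (T.domain.comap A.toFun).map A.domain.subtype

/-- The composition `T A` of partially defined operators, with its natural domain. -/
def operatorComp (T : W →ₗ.[𝕜] Z) (A : V →ₗ.[𝕜] W) : V →ₗ.[𝕜] Z :=
  T.comp (A.domRestrict (compDomain T A)) (by
    rintro ⟨x, ⟨⟨y, hy, rfl⟩, hx⟩⟩
    exact hy)

/-- `E` is a bounded (everywhere defined) extension of the operator `T`. -/
def IsBoundedExtension (T : V →ₗ.[𝕜] W) (E : V →L[𝕜] W) : Prop :=
  ∀ v : T.domain, E v = T v

end Operators

/-! ### Singular value decompositions and POD projections -/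

section SVD

variable {𝕜 : Type*} [RCLike 𝕜] {S X Y : Type*}
  [NormedAddCommGroup S] [InnerProductSpace 𝕜 S]
  [NormedAddCommGroup X] [InnerProductSpace 𝕜 X]
  [NormedAddCommGroup Y] [InnerProductSpace 𝕜 Y]

/-- `(σ, f, φ)` are the ordered singular values and the orthonormal singular vectors of a singular
value decomposition `K g = ∑ₖ σₖ (g, fₖ)_S φₖ`.  Indices start at `0`: `σ k`, `f k`, `φ k` are
the `(k+1)`-st singular value and vectors.  If there are finitely many positive singular values,
the sequence `σ` is continued by zeros; nothing is asked of singular vectors that belong to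
vanishing singular values.  (The inner product of Mathlib is conjugate linear in its first
argument, so `(g, fₖ)_S` is `inner 𝕜 (f k) g`.) -/
structure IsSingularSystem (K : S →L[𝕜] X) (σ : ℕ → ℝ) (f : ℕ → S) (φ : ℕ → X) : Prop where
  antitone : Antitone σ
  nonneg : ∀ k, 0 ≤ σ k
  orthonormal_right : Orthonormal 𝕜 (fun k : {k : ℕ // 0 < σ k} => f k)
  orthonormal_left : Orthonormal 𝕜 (fun k : {k : ℕ // 0 < σ k} => φ k)
  hasSum : ∀ g : S, HasSum (fun k => (σ k : 𝕜) • inner 𝕜 (f k) g • φ k) (K g)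

/-- The number of positive singular values, `s_X` when `σ` are the POD singular values. -/
def numPositive (σ : ℕ → ℝ) : ℕ∞ := {k : ℕ | 0 < σ k}.encard

/-- The numbers `r` of modes for which the POD projections are considered: the first `r` singular
values are positive.  With the order of `ℕ` these are `0, 1, 2, …` if there are infinitely many
positive singular values, and `0, 1, …, s_X` if there are `s_X < ∞`; in the latter case the index
set has the largest element `s_X`, and convergence along `atTop` means that the limit is
attained at `r = s_X`. -/
abbrev ModeCount (σ : ℕ → ℝ) : Type := {r : ℕ // ∀ k < r, 0 < σ k}

/-- The orthogonal projection of `X` onto the span of the first `r` modes. -/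
def podProjection (𝕜 : Type*) [RCLike 𝕜] {X : Type*} [NormedAddCommGroup X]
    [InnerProductSpace 𝕜 X] (φ : ℕ → X) (r : ℕ) : X →L[𝕜] X :=
  haveI : FiniteDimensional 𝕜 (Submodule.span 𝕜 (φ '' Set.Iio r)) :=
    FiniteDimensional.span_of_finite 𝕜 ((Set.finite_Iio r).image φ)
  (Submodule.span 𝕜 (φ '' Set.Iio r)).starProjection

/-- The operator `L Π_r^X L⁻¹`, with its natural domain `{y ∈ R(L) : Π_r^X L⁻¹ y ∈ D(L)}`. -/
def conjugatedProjection (L : X →ₗ.[𝕜] Y) (φ : ℕ → X) (r : ℕ) : Y →ₗ.[𝕜] Y :=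
  operatorComp L ((podProjection 𝕜 φ r).toLinearMap.compPMap L.inverse)

/-- The eigenvalues of `K K* : X → X`, that is, the POD eigenvalues of the data with POD
operator `K`, are all nonzero. -/
def AllPODEigenvaluesNonzero [CompleteSpace S] [CompleteSpace X] (K : S →L[𝕜] X) : Prop :=
  ∀ μ : 𝕜, Module.End.HasEigenvalue
    ((K ∘L ContinuousLinearMap.adjoint K : X →L[𝕜] X) : Module.End 𝕜 X) μ → μ ≠ 0

/-- The modes belonging to positive singular values lie in `D(L)` if `R(K) ⊆ D(L)`. -/
theorem IsSingularSystem.mode_mem {K : S →L[𝕜] X} {σ : ℕ → ℝ} {f : ℕ → S} {φ : ℕ → X}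
    (h : IsSingularSystem K σ f φ) {D : Submodule 𝕜 X} (hK : ∀ g, K g ∈ D) {k : ℕ}
    (hk : 0 < σ k) : φ k ∈ D := by
  have hs := h.hasSum (f k)
  have h1 : HasSum (fun j => (σ j : 𝕜) • inner 𝕜 (f j) (f k) • φ j)
      ((σ k : 𝕜) • inner 𝕜 (f k) (f k) • φ k) := by
    apply hasSum_single
    intro j hj
    rcases (h.nonneg j).lt_or_eq with hp | hp
    · have := h.orthonormal_right.2 (i := ⟨j, hp⟩) (j := ⟨k, hk⟩) (by simpa using hj)
      simp only at this
      simp [this]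
    · simp [← hp]
  have h2 : inner 𝕜 (f k) (f k) = (1 : 𝕜) := by
    have := h.orthonormal_right.1 ⟨k, hk⟩
    simp only at this
    rw [inner_self_eq_norm_sq_to_K, this]
    simp
  have h3 : K (f k) = (σ k : 𝕜) • φ k := by
    rw [hs.unique h1, h2, one_smul]
  have h4 : φ k = (σ k : 𝕜)⁻¹ • K (f k) := by
    rw [h3, smul_smul, inv_mul_cancel₀, one_smul]
    exact_mod_cast hk.ne'
  rw [h4]
  exact D.smul_mem _ (hK _)

end SVD

/-! ### The POD operator of discrete data -/

/-- The space `𝕜^s` with the weighted inner product `(u, v)_S = ∑ⱼ γⱼ uⱼ conj vⱼ`. -/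
def WeightedSpace (𝕜 : Type*) {s : ℕ} (_γ : Fin s → Set.Ioi (0 : ℝ)) : Type _ := Fin s → 𝕜

section Discrete

variable {𝕜 : Type*} [RCLike 𝕜] {s : ℕ} (γ : Fin s → Set.Ioi (0 : ℝ))

instance : AddCommGroup (WeightedSpace 𝕜 γ) := inferInstanceAs (AddCommGroup (Fin s → 𝕜))

instance : Module 𝕜 (WeightedSpace 𝕜 γ) := inferInstanceAs (Module 𝕜 (Fin s → 𝕜))

instance : FiniteDimensional 𝕜 (WeightedSpace 𝕜 γ) :=
  inferInstanceAs (FiniteDimensional 𝕜 (Fin s → 𝕜))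

/-- Mathlib's `inner u v`, conjugate linear in `u`, is `(v, u)_S`. -/
@[reducible]
def weightedCore : InnerProductSpace.Core 𝕜 (WeightedSpace 𝕜 γ) where
  inner u v := ∑ j, ((γ j : ℝ) : 𝕜) * (v j * starRingEnd 𝕜 (u j))
  conj_inner_symm u v := by
    simp [map_sum, mul_comm]
  re_inner_nonneg u := by
    rw [map_sum]
    refine Finset.sum_nonneg fun j _ => ?_
    rw [RCLike.mul_conj, ← RCLike.ofReal_pow, ← RCLike.ofReal_mul, RCLike.ofReal_re]
    have := (γ j).2.out
    positivity
  add_left u v w := by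
    rw [← Finset.sum_add_distrib]
    refine Finset.sum_congr rfl fun j _ => ?_
    change _ * (w j * starRingEnd 𝕜 (u j + v j)) = _
    rw [map_add]; ring
  smul_left u v c := by
    rw [Finset.mul_sum]
    refine Finset.sum_congr rfl fun j _ => ?_
    change _ * (v j * starRingEnd 𝕜 (c * u j)) = _
    rw [map_mul]; ring
  definite u hu := by
    have h0 : ∑ j, (γ j : ℝ) * ‖u j‖ ^ 2 = 0 := by
      have : ((∑ j, (γ j : ℝ) * ‖u j‖ ^ 2 : ℝ) : 𝕜) = 0 := by
        rw [← hu]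
        push_cast
        simp [RCLike.mul_conj]
      exact_mod_cast this
    funext j
    have h1 := (Finset.sum_eq_zero_iff_of_nonneg (fun j _ => by
      have := (γ j).2.out
      positivity)).1 h0 j (Finset.mem_univ j)
    have h2 := (γ j).2.out
    rcases mul_eq_zero.1 h1 with h | h
    · exact absurd h h2.ne'
    · exact norm_eq_zero.1 (pow_eq_zero_iff two_ne_zero |>.1 h)

instance : NormedAddCommGroup (WeightedSpace 𝕜 γ) :=
  @InnerProductSpace.Core.toNormedAddCommGroup 𝕜 _ _ _ _ (weightedCore γ)

instance : InnerProductSpace 𝕜 (WeightedSpace 𝕜 γ) :=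
  InnerProductSpace.ofCore (weightedCore γ).toCore

instance : CompleteSpace (WeightedSpace 𝕜 γ) := FiniteDimensional.complete 𝕜 _

/-- The POD operator `K f = ∑ⱼ γⱼ fⱼ zⱼ` of discrete data `z`. -/
def discretePODOperator (𝕜 : Type*) [RCLike 𝕜] {s : ℕ} (γ : Fin s → Set.Ioi (0 : ℝ))
    {Z : Type*} [NormedAddCommGroup Z] [InnerProductSpace 𝕜 Z] (z : Fin s → Z) : WeightedSpace 𝕜 γ →L[𝕜] Z :=
  LinearMap.toContinuousLinearMap
    { toFun := fun f => ∑ j, ((γ j : ℝ) : 𝕜) • f j • z j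
      map_add' := fun f g => by
        rw [← Finset.sum_add_distrib]
        refine Finset.sum_congr rfl fun j _ => ?_
        change _ • (f j + g j) • z j = _
        rw [add_smul, smul_add]
      map_smul' := fun c f => by
        rw [RingHom.id_apply, Finset.smul_sum]
        refine Finset.sum_congr rfl fun j _ => ?_
        change _ • (c * f j) • z j = _
        rw [mul_smul, smul_comm] }

end Discrete

/-! ### The POD operator of continuous data -/

section Continuous

variable {𝕜 : Type*} [RCLike 𝕜] {α : Type*} [MeasurableSpace α] {μ : Measure α} {m : ℕ}
  {Z : Type*} [NormedAddCommGroup Z] [InnerProductSpace 𝕜 Z]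

/-- The Bochner integral `∫ c(t) z(t) dμ(t)` for scalar `c` and vector valued `z`. -/
def smulIntegral (μ : Measure α) (c : α → 𝕜) (z : α → Z) : Z :=
  letI : NormedSpace ℝ Z := NormedSpace.restrictScalars ℝ 𝕜 Z
  ∫ t, c t • z t ∂μ

theorem memLp_coord (f : Lp (EuclideanSpace 𝕜 (Fin m)) 2 μ) (j : Fin m) :
    MemLp (fun t => f t j) 2 μ := by
  refine (Lp.memLp f).of_le ?_ (Eventually.of_forall fun t => PiLp.norm_apply_le (f t) j)
  exact (EuclideanSpace.proj (𝕜 := 𝕜) j).continuous.comp_aestronglyMeasurable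
    (Lp.aestronglyMeasurable f)

theorem integrable_coord_smul (f : Lp (EuclideanSpace 𝕜 (Fin m)) 2 μ) (j : Fin m)
    (z : Lp Z 2 μ) : Integrable (fun t => f t j • z t) μ :=
  memLp_one_iff_integrable.1 (MemLp.smul (r := 1) (Lp.memLp z) (memLp_coord f j))

theorem norm_smulIntegral_le (f : Lp (EuclideanSpace 𝕜 (Fin m)) 2 μ) (j : Fin m)
    (z : Lp Z 2 μ) : ‖smulIntegral μ (fun t => f t j) z‖ ≤ ‖z‖ * ‖f‖ := by
  let : NormedSpace ℝ Z := NormedSpace.restrictScalars ℝ 𝕜 Z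
  have h1 : ‖smulIntegral μ (fun t => f t j) z‖ₑ ≤ eLpNorm f 2 μ * eLpNorm z 2 μ := by
    refine (enorm_integral_le_lintegral_enorm _).trans ?_
    have h2 := eLpNorm_smul_le_mul_eLpNorm (r := 1) (p := 2) (q := 2)
      (Lp.aestronglyMeasurable z) (memLp_coord f j).1
    rw [eLpNorm_one_eq_lintegral_enorm] at h2
    refine h2.trans ?_
    gcongr
    exact eLpNorm_mono fun t => PiLp.norm_apply_le (f t) j
  have h3 := ENNReal.toReal_mono
    (ENNReal.mul_ne_top (Lp.eLpNorm_ne_top f) (Lp.eLpNorm_ne_top z)) h1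
  rw [ENNReal.toReal_mul, toReal_enorm] at h3
  rw [mul_comm]
  exact h3

/-- The POD operator `K f = ∑ⱼ ∫ fⱼ(t) zⱼ(t) dμ(t)` of the data `z₁, …, z_m ∈ L²(μ; Z)`, defined
for `f ∈ L²(μ; 𝕜^m)`. -/
def continuousPODOperator (𝕜 : Type*) [RCLike 𝕜] {Z : Type*} [NormedAddCommGroup Z]
    [InnerProductSpace 𝕜 Z] (z : Fin m → Lp Z 2 μ) :
    Lp (EuclideanSpace 𝕜 (Fin m)) 2 μ →L[𝕜] Z :=
  LinearMap.mkContinuous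
    { toFun := fun f => ∑ j, smulIntegral μ (fun t => f t j) (z j)
      map_add' := fun f g => by
        let : NormedSpace ℝ Z := NormedSpace.restrictScalars ℝ 𝕜 Z
        rw [← Finset.sum_add_distrib]
        refine Finset.sum_congr rfl fun j _ => ?_
        unfold smulIntegral
        rw [← integral_add (integrable_coord_smul f j (z j)) (integrable_coord_smul g j (z j))]
        refine integral_congr_ae ?_
        filter_upwards [Lp.coeFn_add f g] with t ht
        rw [ht, Pi.add_apply, PiLp.add_apply, add_smul]
      map_smul' := fun c f => by
        let : NormedSpace ℝ Z := NormedSpace.restrictScalars ℝ 𝕜 Z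
        rw [RingHom.id_apply, Finset.smul_sum]
        refine Finset.sum_congr rfl fun j _ => ?_
        unfold smulIntegral
        rw [← integral_smul]
        refine integral_congr_ae ?_
        filter_upwards [Lp.coeFn_smul c f] with t ht
        rw [ht, Pi.smul_apply, PiLp.smul_apply, smul_eq_mul, mul_smul] }
    (∑ j, ‖z j‖) (fun f => by
      rw [Finset.sum_mul]
      exact (norm_sum_le Finset.univ (fun j => smulIntegral μ (fun t => f t j) (z j))).trans
        (Finset.sum_le_sum fun j _ => norm_smulIntegral_le f j (z j)))

end Continuous

end

/-! Write `A` for `K^Y`. All pairs `(K g, A g)` lie in the graph of `L`, so `σ_k L φ_k = A f_k`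
whenever `σ_k > 0` (`smul_operatorValue`), and `L Π_r L⁻¹ A g` is the `r`-th partial sum of `∑ (g,
f_k) A f_k` (`IsSingularSystem.mem_graph_conjugatedProjection`). This series sums to `A g`
(`hasSum_operatorValue`): the part of `g` orthogonal to all `f_k` is killed by `K`, hence by `A`,
because `L` is single-valued; on the rest, continuity of `A` suffices. It converges absolutely by
Bessel's inequality, because `A` is Hilbert-Schmidt (`summable_norm_sq_continuousPODOperator`;
trivial for discrete data). The error on the range of `A` is therefore a tail of a convergent
series. If `A A*` has no eigenvalue zero, then `A` has dense range, and uniform boundedness carries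
the convergence to all of `Y`. For finite `s_X` the range is also finite-dimensional, hence equal to
`Y`. -/

/-! ### Graphs of partially defined operators. -/

section GraphCalculus

variable {𝕜 : Type*} [RCLike 𝕜] {X Y : Type*}
  [NormedAddCommGroup X] [InnerProductSpace 𝕜 X]
  [NormedAddCommGroup Y] [InnerProductSpace 𝕜 Y]

theorem operatorValue_eq_of_mem_graph {L : X →ₗ.[𝕜] Y} {x : X} {y : Y}
    (h : (x, y) ∈ L.graph) : operatorValue L x = y := by
  have hx := LinearPMap.mem_domain_of_mem_graph h
  rw [operatorValue, dif_pos hx]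
  exact ((LinearPMap.image_iff hx).2 h).symm

theorem mem_graph_operatorValue {L : X →ₗ.[𝕜] Y} {x : X} (hx : x ∈ L.domain) :
    (x, operatorValue L x) ∈ L.graph := by
  rw [operatorValue, dif_pos hx]
  exact L.mem_graph ⟨x, hx⟩

/-- Since `L⁻¹ y = x`, the value at `y` is `L Π_r x = z`. Stated with graphs, membership in the
natural domain comes along with the value. -/
theorem mem_graph_conjugatedProjection {L : X →ₗ.[𝕜] Y} (hL : IsInvertibleOperator L)
    {φ : ℕ → X} {r : ℕ} {x : X} {y z : Y} (hxy : (x, y) ∈ L.graph)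
    (hz : (podProjection 𝕜 φ r x, z) ∈ L.graph) :
    (y, z) ∈ (conjugatedProjection L φ r).graph := by
  obtain ⟨u, rfl, rfl⟩ := (LinearPMap.mem_graph_iff L).1 hxy
  have h1 := LinearPMap.mem_inverse_graph hL u
  have hu := LinearPMap.mem_domain_of_mem_graph h1
  have hv : L.inverse ⟨L u, hu⟩ = (u : X) := ((LinearPMap.image_iff hu).2 h1).symm
  obtain ⟨v, hv1, hv2⟩ := (LinearPMap.mem_graph_iff L).1 hz
  have hdom : L u ∈ (conjugatedProjection L φ r).domain := by
    refine ⟨⟨⟨L u, hu⟩, ?_, rfl⟩, hu⟩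
    change podProjection 𝕜 φ r (L.inverse ⟨L u, hu⟩) ∈ L.domain
    rw [hv]
    exact LinearPMap.mem_domain_of_mem_graph hz
  refine (LinearPMap.mem_graph_iff _).2 ⟨⟨L u, hdom⟩, rfl, ?_⟩
  rw [← hv2]
  change L ⟨podProjection 𝕜 φ r (L.inverse ⟨L u, hu⟩), _⟩ = L v
  congr 1
  apply Subtype.ext
  change podProjection 𝕜 φ r (L.inverse ⟨L u, hu⟩) = v
  rw [hv, hv1]

end GraphCalculus

/-! ### Tails of series along the numbers of modes. -/

section Sequences

/-- The tail sums of a sequence tend to zero along the admissible numbers of modes, if the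
terms vanish together with the singular values. -/
theorem tendsto_tsum_Ici_modeCount {σ a : ℕ → ℝ} (hσ : Antitone σ)
    (h0 : ∀ k, σ k ≤ 0 → a k = 0) :
    Tendsto (fun r : ModeCount σ => ∑' k : Set.Ici (r : ℕ), a k) atTop (𝓝 0) := by
  by_cases hpos : ∀ k, 0 < σ k
  · have h1 : Tendsto (fun r : ℕ => ∑' k : Set.Ici r, a k) atTop (𝓝 0) := by
      have h2 := (tendsto_tsum_compl_atTop_zero a).comp tendsto_finset_range
      refine h2.congr fun r => ?_
      have : (Set.Ici r) = {k | k ∉ Finset.range r} := by ext; simp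
      rw [this]
      rfl
    refine h1.comp ?_
    have : Nonempty (ModeCount σ) := ⟨⟨0, fun k _ => hpos k⟩⟩
    refine tendsto_atTop_atTop.2 fun b => ⟨⟨b, fun k _ => hpos k⟩, fun r hr => hr⟩
  -- The first index with vanishing singular value is `s_X`, the largest mode count; from there on
  -- the whole tail is zero.
  · push Not at hpos
    classical
    have hk : ∀ k < Nat.find hpos, 0 < σ k := fun k hk => not_le.1 (Nat.find_min hpos hk)
    refine tendsto_const_nhds.congr' ?_
    filter_upwards [eventually_ge_atTop (⟨Nat.find hpos, hk⟩ : ModeCount σ)] with r hr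
    symm
    have hz : ∀ k : Set.Ici (r : ℕ), a k = 0 := fun k =>
      h0 _ ((hσ (le_trans (show Nat.find hpos ≤ r from hr) k.2)).trans (Nat.find_spec hpos))
    simp [hz]

theorem norm_sub_sum_range_le_tsum_Ici {Y : Type*} [NormedAddCommGroup Y] [CompleteSpace Y]
    {b : ℕ → Y} {y : Y} (hb : HasSum b y) (hs : Summable fun k => ‖b k‖) (r : ℕ) :
    ‖y - ∑ k ∈ Finset.range r, b k‖ ≤ ∑' k : Set.Ici r, ‖b k‖ := by
  have h1 := hb.summable.sum_add_tsum_subtype_compl (Finset.range r)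
  rw [hb.tsum_eq] at h1
  have : (Set.Ici r) = {k | k ∉ Finset.range r} := by ext; simp
  rw [← h1, add_sub_cancel_left, this]
  exact norm_tsum_le_tsum_norm (hs.subtype _)

end Sequences

/-! ### Bounded extensions and the density argument. -/

section Extension

variable {𝕜 : Type*} [RCLike 𝕜] {Y Z : Type*}
  [NormedAddCommGroup Y] [NormedSpace 𝕜 Y] [NormedAddCommGroup Z] [NormedSpace 𝕜 Z]

theorem exists_isBoundedExtension [CompleteSpace Z] {T : Y →ₗ.[𝕜] Z}
    (hT : Dense (T.domain : Set Y)) {C : ℝ} (hC : ∀ y : T.domain, ‖T y‖ ≤ C * ‖(y : Y)‖) :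
    ∃ E : Y →L[𝕜] Z, IsBoundedExtension T E ∧ ∀ y, ‖E y‖ ≤ C * ‖y‖ := by
  have hd : DenseRange T.domain.subtype := by simpa [DenseRange] using hT
  exact ⟨T.toFun.extendOfNorm T.domain.subtype,
    fun v => LinearMap.extendOfNorm_eq hd ⟨C, hC⟩ v,
    LinearMap.norm_extendOfNorm_apply_le hd C hC⟩

theorem IsBoundedExtension.eq {T : Y →ₗ.[𝕜] Z} (hT : Dense (T.domain : Set Y))
    {E E' : Y →L[𝕜] Z} (hE : IsBoundedExtension T E) (hE' : IsBoundedExtension T E') :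
    E' = E := by
  apply ContinuousLinearMap.coeFn_injective
  refine Continuous.ext_on hT E'.continuous E.continuous fun y hy => ?_
  rw [hE ⟨y, hy⟩, hE' ⟨y, hy⟩]

/-- Uniformly bounded operators which converge to the identity on a dense set converge to the
identity everywhere. -/
theorem tendsto_apply_self_of_dense {ι : Type*} {l : Filter ι} {E : ι → Y →L[𝕜] Y} {C : ℝ}
    (hC : ∀ i y, ‖E i y‖ ≤ C * ‖y‖) {D : Set Y} (hD : Dense D)
    (h : ∀ y ∈ D, Tendsto (fun i => E i y) l (𝓝 y)) (y : Y) :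
    Tendsto (fun i => E i y) l (𝓝 y) := by
  rw [Metric.tendsto_nhds]
  intro ε hε
  have hM : 0 < |C| + 2 := by positivity
  obtain ⟨z, hz, hyz⟩ := Metric.mem_closure_iff.1 (hD y) (ε / (|C| + 2)) (by positivity)
  rw [lt_div_iff₀ hM, dist_eq_norm] at hyz
  -- The radius equals `ε - (|C| + 1) ‖y - z‖`, which is positive by the choice of `z`; the other
  -- two terms of the splitting below use up exactly `(|C| + 1) ‖y - z‖`.
  filter_upwards [Metric.tendsto_nhds.1 (h z hz) (‖y - z‖ + (ε - ‖y - z‖ * (|C| + 2)))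
    (by have := norm_nonneg (y - z); linarith)] with i hi
  rw [dist_eq_norm] at hi ⊢
  have h1 : E i y - y = E i (y - z) + (E i z - z) + (z - y) := by rw [map_sub]; abel
  have h2 : ‖E i (y - z)‖ ≤ |C| * ‖y - z‖ :=
    (hC i _).trans (by gcongr; exact le_abs_self C)
  have h3 : ‖E i y - y‖ ≤ ‖E i (y - z)‖ + ‖E i z - z‖ + ‖y - z‖ := by
    rw [h1, norm_sub_rev y z]
    exact norm_add₃_le
  nlinarith

end Extension

/-! ### Singular systems transported by `L`. -/

section Abstract

variable {𝕜 : Type*} [RCLike 𝕜] {S X Y : Type*}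
  [NormedAddCommGroup S] [InnerProductSpace 𝕜 S]
  [NormedAddCommGroup X] [InnerProductSpace 𝕜 X]
  [NormedAddCommGroup Y] [InnerProductSpace 𝕜 Y]

namespace IsSingularSystem

variable {K : S →L[𝕜] X} {σ : ℕ → ℝ} {f : ℕ → S} {φ : ℕ → X}

theorem apply_mode (h : IsSingularSystem K σ f φ) {k : ℕ} (hk : 0 < σ k) :
    K (f k) = (σ k : 𝕜) • φ k := by
  have h1 : HasSum (fun j => (σ j : 𝕜) • inner 𝕜 (f j) (f k) • φ j)
      ((σ k : 𝕜) • inner 𝕜 (f k) (f k) • φ k) := by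
    apply hasSum_single
    intro j hj
    rcases (h.nonneg j).lt_or_eq with hp | hp
    · have := h.orthonormal_right.2 (i := ⟨j, hp⟩) (j := ⟨k, hk⟩) (by simpa using hj)
      simp only at this
      simp [this]
    · simp [← hp]
  have h2 : inner 𝕜 (f k) (f k) = (1 : 𝕜) := by
    have := h.orthonormal_right.1 ⟨k, hk⟩
    simp only at this
    rw [inner_self_eq_norm_sq_to_K, this]
    simp
  rw [(h.hasSum (f k)).unique h1, h2, one_smul]

/-- The projection is continuous, so it acts termwise: it fixes the first `r` modes and annihilates
the later ones by orthogonality. Modes with `σ_k = 0` are arbitrary vectors, but their coefficient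
vanishes. -/
theorem podProjection_apply (h : IsSingularSystem K σ f φ) (r : ModeCount σ) (g : S) :
    podProjection 𝕜 φ r (K g) =
      ∑ k ∈ Finset.range r, (σ k : 𝕜) • inner 𝕜 (f k) g • φ k := by
  have : FiniteDimensional 𝕜 (Submodule.span 𝕜 (φ '' Set.Iio (r : ℕ))) :=
    FiniteDimensional.span_of_finite 𝕜 ((Set.finite_Iio (r : ℕ)).image φ)
  have hin : ∀ k < (r : ℕ), podProjection 𝕜 φ r (φ k) = φ k := fun k hk =>
    Submodule.starProjection_eq_self_iff.2
      (Submodule.subset_span (Set.mem_image_of_mem φ hk))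
  have hout : ∀ k, (r : ℕ) ≤ k → 0 < σ k → podProjection 𝕜 φ r (φ k) = 0 := by
    intro k hk hσ
    refine (Submodule.starProjection_apply_eq_zero_iff _).2 ?_
    rw [Submodule.mem_orthogonal]
    intro u hu
    induction hu using Submodule.span_induction with
    | mem x hx =>
      obtain ⟨j, hj, rfl⟩ := hx
      have hj' : j < (r : ℕ) := hj
      exact h.orthonormal_left.2 (i := ⟨j, r.2 j hj'⟩) (j := ⟨k, hσ⟩) (by
        rw [ne_eq, Subtype.mk.injEq]; omega)
    | zero => simp
    | add x y _ _ hx hy => rw [inner_add_left, hx, hy, add_zero]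
    | smul a x _ hx => rw [inner_smul_left, hx, mul_zero]
  have h1 := (podProjection 𝕜 φ r).hasSum (h.hasSum g)
  refine h1.unique ?_
  have h2 : ∑ k ∈ Finset.range r, (σ k : 𝕜) • inner 𝕜 (f k) g • φ k =
      ∑ k ∈ Finset.range r, podProjection 𝕜 φ r ((σ k : 𝕜) • inner 𝕜 (f k) g • φ k) := by
    refine Finset.sum_congr rfl fun k hk => ?_
    rw [map_smul, map_smul, hin k (Finset.mem_range.1 hk)]
  rw [h2]
  refine hasSum_sum_of_ne_finset_zero fun k hk => ?_
  rcases (h.nonneg k).lt_or_eq with hp | hp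
  · rw [map_smul, map_smul, hout k (by simpa using hk) hp, smul_zero, smul_zero]
  · simp [← hp]

variable {L : X →ₗ.[𝕜] Y} {A : S →L[𝕜] Y}

/-- Both sides are values of `L` at `σ_k φ_k = K f_k`. -/
theorem smul_operatorValue (h : IsSingularSystem K σ f φ)
    (hKA : ∀ g, (K g, A g) ∈ L.graph) {k : ℕ} (hk : 0 < σ k) :
    (σ k : 𝕜) • operatorValue L (φ k) = A (f k) := by
  have hφ : φ k ∈ L.domain :=
    h.mode_mem (fun g => LinearPMap.mem_domain_of_mem_graph (hKA g)) hk
  have h1 := L.graph.smul_mem (σ k : 𝕜) (mem_graph_operatorValue hφ)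
  have h2 := hKA (f k)
  rw [h.apply_mode hk] at h2
  exact LinearPMap.mem_graph_snd_inj L h1 h2 rfl

theorem term_eq (h : IsSingularSystem K σ f φ) (hKA : ∀ g, (K g, A g) ∈ L.graph) (g : S)
    {k : ℕ} (hk : 0 < σ k) :
    (σ k : 𝕜) • inner 𝕜 (f k) g • operatorValue L (φ k) = inner 𝕜 (f k) g • A (f k) := by
  rw [smul_comm, h.smul_operatorValue hKA hk]

theorem norm_term (h : IsSingularSystem K σ f φ) (L : X →ₗ.[𝕜] Y) (g : S) (k : ℕ) :
    ‖(σ k : 𝕜) • inner 𝕜 (f k) g • operatorValue L (φ k)‖ =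
      σ k * ‖inner 𝕜 (f k) g‖ * ‖operatorValue L (φ k)‖ := by
  rw [norm_smul, norm_smul, RCLike.norm_ofReal, abs_of_nonneg (h.nonneg k), mul_assoc]

theorem summable_norm_term (h : IsSingularSystem K σ f φ)
    (hKA : ∀ g, (K g, A g) ∈ L.graph)
    (hA : Summable fun k : {k : ℕ // 0 < σ k} => ‖A (f k)‖ ^ 2) (g : S) :
    Summable fun k => σ k * ‖inner 𝕜 (f k) g‖ * ‖operatorValue L (φ k)‖ := by
  have h1 : Summable fun k : {k : ℕ // 0 < σ k} => ‖inner 𝕜 (f k) g‖ * ‖A (f k)‖ := by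
    refine Summable.of_nonneg_of_le (fun k => by positivity) (fun k => ?_)
      ((h.orthonormal_right.inner_products_summable g).add hA)
    -- The inequality `ab ≤ a² + b²`; the two squares are summable by Bessel and by the
    -- Hilbert-Schmidt assumption `hA`.
    nlinarith [sq_nonneg (‖inner 𝕜 (f k) g‖ - ‖A (f k)‖), sq_nonneg ‖inner 𝕜 (f k) g‖,
      sq_nonneg ‖A (f k)‖]
  have hinj : Function.Injective (Subtype.val : {k : ℕ // 0 < σ k} → ℕ) :=
    Subtype.val_injective
  refine (hinj.summable_iff fun k hk => ?_).1 (h1.congr fun k => ?_)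
  · have : σ k = 0 := by
      by_contra h0
      exact hk ⟨⟨k, lt_of_le_of_ne (h.nonneg k) (Ne.symm h0)⟩, rfl⟩
    simp [this]
  · simp only [Function.comp_apply]
    rw [← h.norm_term, h.term_eq hKA g k.2, norm_smul]

/-- The operator `A = L K` is represented by the series obtained by applying `L` termwise to the
singular value decomposition of `K`. -/
theorem hasSum_operatorValue [CompleteSpace S] (h : IsSingularSystem K σ f φ)
    (hKA : ∀ g, (K g, A g) ∈ L.graph) (g : S) :
    HasSum (fun k => (σ k : 𝕜) • inner 𝕜 (f k) g • operatorValue L (φ k)) (A g) := by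
  have hinj : Function.Injective (Subtype.val : {k : ℕ // 0 < σ k} → ℕ) :=
    Subtype.val_injective
  have hzero : ∀ k ∉ Set.range (Subtype.val : {k : ℕ // 0 < σ k} → ℕ), σ k = 0 := by
    intro k hk
    by_contra h0
    exact hk ⟨⟨k, lt_of_le_of_ne (h.nonneg k) (Ne.symm h0)⟩, rfl⟩
  have hs : Summable fun k : {k : ℕ // 0 < σ k} => inner 𝕜 (f k) g • f k :=
    (h.orthonormal_right.orthogonalFamily.summable_iff_norm_sq_summable
      (fun k : {k : ℕ // 0 < σ k} => (inner 𝕜 (f k) g : 𝕜))).2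
      (h.orthonormal_right.inner_products_summable g)
  obtain ⟨g', hg'⟩ := hs
  -- `g'` is the projection of `g` onto the closed span of the `f_k` with `σ_k > 0`; `K` does not
  -- see the difference.
  have hK : K g' = K g := by
    refine (K.hasSum hg').unique ?_
    refine ((hinj.hasSum_iff fun k hk => ?_).2 (h.hasSum g)).congr_fun ?_
    · simp [hzero k hk]
    · intro k
      simp only [Function.comp_apply]
      rw [map_smul, h.apply_mode k.2, smul_comm]
  -- Single-valuedness of `L` transfers the equality from `K` to `A`, so `L` never has to be
  -- interchanged with a limit.
  have hAg : A g' = A g := LinearPMap.mem_graph_snd_inj L (hKA g') (hKA g) hK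
  rw [← hAg]
  refine (hinj.hasSum_iff fun k hk => ?_).1 ((A.hasSum hg').congr_fun ?_)
  · simp [hzero k hk]
  · intro k
    simp only [Function.comp_apply]
    rw [map_smul, h.term_eq hKA g k.2]

theorem mem_graph_conjugatedProjection (hL : IsInvertibleOperator L)
    (h : IsSingularSystem K σ f φ) (hKA : ∀ g, (K g, A g) ∈ L.graph) (g : S)
    (r : ModeCount σ) :
    (A g, ∑ k ∈ Finset.range r, (σ k : 𝕜) • inner 𝕜 (f k) g • operatorValue L (φ k)) ∈
      (conjugatedProjection L φ r).graph := by
  refine _root_.mem_graph_conjugatedProjection hL (hKA g) ?_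
  have hsum : (∑ k ∈ Finset.range r, (σ k : 𝕜) • inner 𝕜 (f k) g • φ k,
      ∑ k ∈ Finset.range r, (σ k : 𝕜) • inner 𝕜 (f k) g • operatorValue L (φ k)) =
      ∑ k ∈ Finset.range r,
        (σ k : 𝕜) • inner 𝕜 (f k) g • ((φ k, operatorValue L (φ k)) : X × Y) := by
    ext <;> simp [Prod.fst_sum, Prod.snd_sum]
  rw [h.podProjection_apply, hsum]
  refine Submodule.sum_mem _ fun k hk => ?_
  have hφ : φ k ∈ L.domain :=
    h.mode_mem (fun g => LinearPMap.mem_domain_of_mem_graph (hKA g))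
      (r.2 k (Finset.mem_range.1 hk))
  exact L.graph.smul_mem _ (L.graph.smul_mem _ (mem_graph_operatorValue hφ))

/-- Error bound and convergence on the range of `A = L K`. -/
theorem error_bound_and_tendsto [CompleteSpace S] [CompleteSpace Y] (hL : IsInvertibleOperator L)
    (h : IsSingularSystem K σ f φ) (hKA : ∀ g, (K g, A g) ∈ L.graph)
    (hA : Summable fun k : {k : ℕ // 0 < σ k} => ‖A (f k)‖ ^ 2) (g : S) (y : Y)
    (hy : y = A g) :
    Summable (fun k => σ k * ‖inner 𝕜 (f k) g‖ * ‖operatorValue L (φ k)‖) ∧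
      ∃ hy : ∀ r : ModeCount σ, y ∈ (conjugatedProjection L φ r).domain,
        (∀ r : ModeCount σ, ‖y - conjugatedProjection L φ r ⟨y, hy r⟩‖ ≤
          ∑' k : Set.Ici (r : ℕ), σ k * ‖inner 𝕜 (f k) g‖ * ‖operatorValue L (φ k)‖) ∧
        Tendsto (fun r : ModeCount σ => ‖y - conjugatedProjection L φ r ⟨y, hy r⟩‖)
          atTop (𝓝 0) := by
  subst hy
  have hsum := h.summable_norm_term hKA hA g
  have hgr := h.mem_graph_conjugatedProjection hL hKA g
  have hbound : ∀ r : ModeCount σ,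
      ‖A g - conjugatedProjection L φ r ⟨A g, LinearPMap.mem_domain_of_mem_graph (hgr r)⟩‖ ≤
        ∑' k : Set.Ici (r : ℕ), σ k * ‖inner 𝕜 (f k) g‖ * ‖operatorValue L (φ k)‖ := by
    intro r
    rw [← (LinearPMap.image_iff (LinearPMap.mem_domain_of_mem_graph (hgr r))).2 (hgr r)]
    simp_rw [← h.norm_term L g] at hsum ⊢
    exact norm_sub_sum_range_le_tsum_Ici (h.hasSum_operatorValue hKA g) hsum r
  refine ⟨hsum, fun r => LinearPMap.mem_domain_of_mem_graph (hgr r), hbound, ?_⟩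
  refine squeeze_zero (fun r => norm_nonneg _) hbound
    (tendsto_tsum_Ici_modeCount
      (a := fun k => σ k * ‖inner 𝕜 (f k) g‖ * ‖operatorValue L (φ k)‖) h.antitone fun k hk => ?_)
  rw [le_antisymm hk (h.nonneg k), zero_mul, zero_mul]

/-- The series for `A g` becomes a finite sum, so the range lies in the span of finitely many `L
φ_k`. -/
theorem finiteDimensional_range [CompleteSpace S] (h : IsSingularSystem K σ f φ)
    (hKA : ∀ g, (K g, A g) ∈ L.graph) (hσ : numPositive σ < ⊤) :
    FiniteDimensional 𝕜 (LinearMap.range A.toLinearMap) := by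
  have hfin : {k : ℕ | 0 < σ k}.Finite := Set.encard_lt_top_iff.1 hσ
  have : FiniteDimensional 𝕜
      (Submodule.span 𝕜 ((fun k => operatorValue L (φ k)) '' {k : ℕ | 0 < σ k})) :=
    FiniteDimensional.span_of_finite 𝕜 (hfin.image _)
  refine Submodule.finiteDimensional_of_le
    (S₂ := Submodule.span 𝕜 ((fun k => operatorValue L (φ k)) '' {k : ℕ | 0 < σ k})) ?_
  rintro _ ⟨g, rfl⟩
  have h1 := h.hasSum_operatorValue hKA g
  have h2 : A g = ∑ k ∈ hfin.toFinset,
      (σ k : 𝕜) • inner 𝕜 (f k) g • operatorValue L (φ k) := by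
    refine h1.unique (hasSum_sum_of_ne_finset_zero fun k hk => ?_)
    have : σ k = 0 := le_antisymm (by simpa using hk) (h.nonneg k)
    simp [this]
  change A g ∈ _
  rw [h2]
  refine Submodule.sum_mem _ fun k hk => Submodule.smul_mem _ _ (Submodule.smul_mem _ _ ?_)
  exact Submodule.subset_span ⟨k, by simpa using hk, rfl⟩

end IsSingularSystem

/-- A nonzero vector orthogonal to the range lies in the kernel of `A*`, and is then an eigenvector
of `A A*` with eigenvalue zero. -/
theorem AllPODEigenvaluesNonzero.dense_range [CompleteSpace S] [CompleteSpace Y]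
    {A : S →L[𝕜] Y} (hA : AllPODEigenvaluesNonzero A) :
    Dense (LinearMap.range A.toLinearMap : Set Y) := by
  rw [Submodule.dense_iff_topologicalClosure_eq_top, Submodule.topologicalClosure_eq_top_iff,
    Submodule.eq_bot_iff]
  intro u hu
  have h1 : ContinuousLinearMap.adjoint A u = 0 := by
    refine ext_inner_left 𝕜 fun v => ?_
    rw [ContinuousLinearMap.adjoint_inner_right, inner_zero_right]
    exact hu _ ⟨v, rfl⟩
  by_contra h0
  refine hA 0 (Module.End.hasEigenvalue_of_hasEigenvector (x := u) ⟨?_, h0⟩) rfl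
  rw [Module.End.mem_eigenspace_iff, zero_smul]
  change A (ContinuousLinearMap.adjoint A u) = 0
  rw [h1, map_zero]

namespace IsSingularSystem

variable {K : S →L[𝕜] X} {σ : ℕ → ℝ} {f : ℕ → S} {φ : ℕ → X}
  {L : X →ₗ.[𝕜] Y} {A : S →L[𝕜] Y}

/-- Convergence of the bounded extensions of `L Π_r^X L⁻¹` on the whole space. -/
theorem exists_extension_tendsto [CompleteSpace S] [CompleteSpace Y]
    (hL : IsInvertibleOperator L) (h : IsSingularSystem K σ f φ)
    (hKA : ∀ g, (K g, A g) ∈ L.graph)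
    (hA : Summable fun k : {k : ℕ // 0 < σ k} => ‖A (f k)‖ ^ 2)
    (hbdd : numPositive σ = ⊤ → ∃ C : ℝ, ∀ (r : ModeCount σ)
      (y : (conjugatedProjection L φ r).domain),
      ‖conjugatedProjection L φ r y‖ ≤ C * ‖(y : Y)‖)
    (heig : AllPODEigenvaluesNonzero A) :
    (numPositive σ < ⊤ → ∀ r : ModeCount σ, (conjugatedProjection L φ r).domain = ⊤) ∧
      ∃ E : ModeCount σ → Y →L[𝕜] Y,
        (∀ r : ModeCount σ, IsBoundedExtension (conjugatedProjection L φ r) (E r) ∧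
          ∀ E', IsBoundedExtension (conjugatedProjection L φ r) E' → E' = E r) ∧
        ∀ y : Y, Tendsto (fun r => E r y) atTop (𝓝 y) := by
  have hdense := heig.dense_range
  have hsub : ∀ r : ModeCount σ,
      LinearMap.range A.toLinearMap ≤ (conjugatedProjection L φ r).domain := by
    rintro r _ ⟨g, rfl⟩
    exact LinearPMap.mem_domain_of_mem_graph (h.mem_graph_conjugatedProjection hL hKA g r)
  have hdom : ∀ r : ModeCount σ, Dense ((conjugatedProjection L φ r).domain : Set Y) :=
    fun r => hdense.mono (hsub r)
  have hconv : ∀ E : ModeCount σ → Y →L[𝕜] Y,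
      (∀ r : ModeCount σ, IsBoundedExtension (conjugatedProjection L φ r) (E r)) →
      ∀ y ∈ (LinearMap.range A.toLinearMap : Set Y),
        Tendsto (fun r => E r y) atTop (𝓝 y) := by
    rintro E hE _ ⟨g, rfl⟩
    obtain ⟨-, hy, -, ht⟩ := h.error_bound_and_tendsto hL hKA hA g (A g) rfl
    rw [tendsto_iff_norm_sub_tendsto_zero]
    refine ht.congr fun r => ?_
    rw [norm_sub_rev, ← hE r ⟨A g, hy r⟩]
    rfl
  rcases eq_or_ne (numPositive σ) ⊤ with hσ | hσ
  · refine ⟨fun hlt => absurd hσ hlt.ne, ?_⟩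
    obtain ⟨C, hC⟩ := hbdd hσ
    choose E hE hEC using fun r => exists_isBoundedExtension (hdom r) (hC r)
    exact ⟨E, fun r => ⟨hE r, fun E' hE' => (hE r).eq (hdom r) hE'⟩,
      tendsto_apply_self_of_dense hEC hdense (hconv E hE)⟩
  · have hfin := h.finiteDimensional_range hKA hσ.lt_top
    -- A finite-dimensional subspace is closed, so density makes it everything.
    have htop : LinearMap.range A.toLinearMap = ⊤ := by
      rw [← (Submodule.closed_of_finiteDimensional
        (LinearMap.range A.toLinearMap)).submodule_topologicalClosure_eq]
      exact Submodule.dense_iff_topologicalClosure_eq_top.1 hdense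
    have hY : FiniteDimensional 𝕜 Y := by
      rw [htop] at hfin
      exact Module.Finite.equiv (Submodule.topEquiv (R := 𝕜) (M := Y))
    have hdomtop : ∀ r : ModeCount σ, (conjugatedProjection L φ r).domain = ⊤ :=
      fun r => top_le_iff.1 (htop ▸ hsub r)
    refine ⟨fun _ => hdomtop, ?_⟩
    have hex : ∀ r : ModeCount σ, ∃ E : Y →L[𝕜] Y,
        IsBoundedExtension (conjugatedProjection L φ r) E := by
      intro r
      -- Continuity is automatic because `Y` is finite-dimensional, so no uniform bound is required
      -- here: the limit is attained at the largest mode count.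
      let T := LinearMap.toContinuousLinearMap (conjugatedProjection L φ r).toFun
      obtain ⟨E, hE, -⟩ := exists_isBoundedExtension (hdom r) (C := ‖T‖) fun y => T.le_opNorm y
      exact ⟨E, hE⟩
    choose E hE using hex
    refine ⟨E, fun r => ⟨hE r, fun E' hE' => (hE r).eq (hdom r) hE'⟩, fun y => ?_⟩
    exact hconv E hE y (by rw [htop]; trivial)

end IsSingularSystem

end Abstract

/-! ### Hilbert-Schmidt bounds through the adjoint. -/

section HilbertSchmidt

variable {𝕜 : Type*} [RCLike 𝕜] {S Y : Type*}
  [NormedAddCommGroup S] [InnerProductSpace 𝕜 S] [CompleteSpace S]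
  [NormedAddCommGroup Y] [InnerProductSpace 𝕜 Y] [CompleteSpace Y]

/-- Testing with `f = A* e` gives `‖A* e‖² ≤ c ‖A* e‖`. -/
theorem norm_adjoint_apply_le {A : S →L[𝕜] Y} {e : Y} {c : ℝ} (hc : 0 ≤ c)
    (h : ∀ f, ‖inner 𝕜 e (A f)‖ ≤ c * ‖f‖) : ‖ContinuousLinearMap.adjoint A e‖ ≤ c := by
  have h1 := h (ContinuousLinearMap.adjoint A e)
  rw [← ContinuousLinearMap.adjoint_inner_left, inner_self_eq_norm_sq_to_K, ← RCLike.ofReal_pow,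
    RCLike.norm_ofReal, abs_of_nonneg (sq_nonneg _), sq] at h1
  rcases (norm_nonneg (ContinuousLinearMap.adjoint A e)).eq_or_lt with h0 | h0
  · rw [← h0]; exact hc
  · exact le_of_mul_le_mul_right h1 h0

/-- Bessel's inequality for Hilbert-Schmidt operators. -/
theorem Orthonormal.summable_norm_sq_apply {ι : Type*} {v : ι → S} (hv : Orthonormal 𝕜 v)
    {A : S →L[𝕜] Y} {M : ℝ}
    (hM : ∀ (n : ℕ) (e : Fin n → Y), Orthonormal 𝕜 e →
      ∑ i, ‖ContinuousLinearMap.adjoint A (e i)‖ ^ 2 ≤ M) :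
    Summable fun i => ‖A (v i)‖ ^ 2 := by
  refine summable_of_sum_le (c := M) (fun i => by positivity) fun s => ?_
  have : FiniteDimensional 𝕜 (Submodule.span 𝕜 ((fun i => A (v i)) '' (s : Set ι))) :=
    FiniteDimensional.span_of_finite 𝕜 (s.finite_toSet.image _)
  -- Parseval in this basis turns `‖A v_k‖²` into `∑ᵢ |(v_k, A* bᵢ)|²`; after exchanging the sums,
  -- Bessel for `v` bounds the sum over `k` by `‖A* bᵢ‖²`.
  let b := stdOrthonormalBasis 𝕜 (Submodule.span 𝕜 ((fun i => A (v i)) '' (s : Set ι)))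
  have he : Orthonormal 𝕜 fun i => (b i : Y) :=
    b.orthonormal.comp_linearIsometry (Submodule.subtypeₗᵢ _)
  have h1 : ∀ k ∈ s, ‖A (v k)‖ ^ 2 =
      ∑ i, ‖inner 𝕜 (v k) (ContinuousLinearMap.adjoint A (b i : Y))‖ ^ 2 := by
    intro k hk
    have h2 := b.sum_sq_norm_inner_right
      ⟨A (v k), Submodule.subset_span ⟨k, hk, rfl⟩⟩
    rw [Submodule.coe_norm] at h2
    rw [← h2]
    refine Finset.sum_congr rfl fun i _ => ?_
    rw [ContinuousLinearMap.adjoint_inner_right, norm_inner_symm]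
    rfl
  rw [Finset.sum_congr rfl h1, Finset.sum_comm]
  exact (Finset.sum_le_sum fun i _ => hv.sum_inner_products_le _).trans (hM _ _ he)

end HilbertSchmidt

/-! ### Continuous data give Hilbert-Schmidt operators. -/

section L2Kernel

variable {𝕜 : Type*} [RCLike 𝕜] {α : Type*} [MeasurableSpace α] {μ : Measure α} {m : ℕ}
  {Z : Type*} [NormedAddCommGroup Z] [InnerProductSpace 𝕜 Z]

theorem norm_sq_eq_integral_norm_sq (𝕜 : Type*) [RCLike 𝕜] {Z : Type*} [NormedAddCommGroup Z]
    [InnerProductSpace 𝕜 Z] (z : Lp Z 2 μ) : ‖z‖ ^ 2 = ∫ t, ‖z t‖ ^ 2 ∂μ := by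
  have h : ((‖z‖ ^ 2 : ℝ) : 𝕜) = ((∫ t, ‖z t‖ ^ 2 ∂μ : ℝ) : 𝕜) := by
    rw [← integral_ofReal, RCLike.ofReal_pow, ← inner_self_eq_norm_sq_to_K, L2.inner_def]
    simp_rw [inner_self_eq_norm_sq_to_K, RCLike.ofReal_pow]
  exact_mod_cast h

theorem integrable_norm_sq {Z : Type*} [NormedAddCommGroup Z] (z : Lp Z 2 μ) :
    Integrable (fun t => ‖z t‖ ^ 2) μ :=
  (memLp_two_iff_integrable_sq_norm (Lp.aestronglyMeasurable z)).1 (Lp.memLp z)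

/-- Bessel's inequality for `z t` at almost every `t`, integrated. -/
theorem sum_norm_sq_innerSL_compLp_le {n : ℕ} {e : Fin n → Z} (he : Orthonormal 𝕜 e)
    (z : Lp Z 2 μ) : ∑ i, ‖(innerSL 𝕜 (e i)).compLp z‖ ^ 2 ≤ ‖z‖ ^ 2 := by
  rw [norm_sq_eq_integral_norm_sq 𝕜 z]
  simp_rw [norm_sq_eq_integral_norm_sq 𝕜]
  rw [← integral_finsetSum _ fun i _ => integrable_norm_sq ((innerSL 𝕜 (e i)).compLp z)]
  refine integral_mono_ae
    (integrable_finsetSum _ fun i _ => integrable_norm_sq ((innerSL 𝕜 (e i)).compLp z))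
    (integrable_norm_sq z) ?_
  have h : ∀ᵐ t ∂μ, ∀ i, (innerSL 𝕜 (e i)).compLp z t = inner 𝕜 (e i) (z t) :=
    ae_all_iff.2 fun i => (innerSL 𝕜 (e i)).coeFn_compLp z
  filter_upwards [h] with t ht
  simp_rw [ht]
  exact he.sum_inner_products_le _

variable [CompleteSpace Z]

theorem inner_smulIntegral (f : Lp (EuclideanSpace 𝕜 (Fin m)) 2 μ) (j : Fin m) (z : Lp Z 2 μ)
    (e : Z) : inner 𝕜 e (smulIntegral μ (fun t => f t j) z) =
      smulIntegral μ (fun t => f t j) ((innerSL 𝕜 e).compLp z) := by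
  let : NormedSpace ℝ Z := NormedSpace.restrictScalars ℝ 𝕜 Z
  let : NormedSpace ℝ 𝕜 := NormedSpace.restrictScalars ℝ 𝕜 𝕜
  refine ((innerSL 𝕜 e).integral_comp_comm (integrable_coord_smul f j z)).symm.trans ?_
  refine integral_congr_ae ?_
  filter_upwards [(innerSL 𝕜 e).coeFn_compLp z] with t ht
  rw [ht, map_smul]

/-- The factor `m` is the price of Cauchy-Schwarz, `(∑ⱼ aⱼ)² ≤ m ∑ⱼ aⱼ²`; only finiteness of the
resulting bound matters. -/
theorem norm_adjoint_continuousPODOperator_sq_le (z : Fin m → Lp Z 2 μ) (e : Z) :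
    ‖ContinuousLinearMap.adjoint (continuousPODOperator 𝕜 z) e‖ ^ 2 ≤
      m * ∑ j, ‖(innerSL 𝕜 e).compLp (z j)‖ ^ 2 := by
  have h1 : ‖ContinuousLinearMap.adjoint (continuousPODOperator 𝕜 z) e‖ ≤
      ∑ j, ‖(innerSL 𝕜 e).compLp (z j)‖ := by
    refine norm_adjoint_apply_le (Finset.sum_nonneg fun j _ => norm_nonneg _) fun f => ?_
    change ‖inner 𝕜 e (∑ j, smulIntegral μ (fun t => f t j) (z j))‖ ≤ _
    rw [inner_sum, Finset.sum_mul]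
    refine norm_sum_le_of_le _ fun j _ => ?_
    rw [inner_smulIntegral]
    exact norm_smulIntegral_le f j _
  calc _ ≤ (∑ j, ‖(innerSL 𝕜 e).compLp (z j)‖) ^ 2 := by gcongr
    _ ≤ _ := by
      simpa using sq_sum_le_card_mul_sum_sq (s := Finset.univ)
        (f := fun j => ‖(innerSL 𝕜 e).compLp (z j)‖)

theorem summable_norm_sq_continuousPODOperator (z : Fin m → Lp Z 2 μ) {ι : Type*}
    {v : ι → Lp (EuclideanSpace 𝕜 (Fin m)) 2 μ} (hv : Orthonormal 𝕜 v) :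
    Summable fun i => ‖continuousPODOperator 𝕜 z (v i)‖ ^ 2 := by
  refine hv.summable_norm_sq_apply (M := m * ∑ j, ‖z j‖ ^ 2) fun n e he => ?_
  refine (Finset.sum_le_sum fun i _ =>
    norm_adjoint_continuousPODOperator_sq_le z (e i)).trans ?_
  rw [← Finset.mul_sum, Finset.sum_comm]
  gcongr with j
  exact sum_norm_sq_innerSL_compLp_le he (z j)

end L2Kernel

/-! ### Discrete data and the conclusion. -/

section Discrete

variable {𝕜 : Type*} [RCLike 𝕜] {s : ℕ} (γ : Fin s → Set.Ioi (0 : ℝ))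
  {X Y : Type*} [NormedAddCommGroup X] [InnerProductSpace 𝕜 X]
  [NormedAddCommGroup Y] [InnerProductSpace 𝕜 Y]

theorem discretePODOperator_mem_graph (L : X →ₗ.[𝕜] Y) (w : Fin s → L.domain)
    (g : WeightedSpace 𝕜 γ) :
    (discretePODOperator 𝕜 γ (fun j => (w j : X)) g,
      discretePODOperator 𝕜 γ (fun j => L (w j)) g) ∈ L.graph := by
  have h : (discretePODOperator 𝕜 γ (fun j => (w j : X)) g,
      discretePODOperator 𝕜 γ (fun j => L (w j)) g) =
      ∑ j, ((γ j : ℝ) : 𝕜) • g j • (((w j : X), L (w j)) : X × Y) := by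
    ext
    · simp [Prod.fst_sum]; rfl
    · simp [Prod.snd_sum]; rfl
  rw [h]
  exact Submodule.sum_mem _ fun j _ =>
    L.graph.smul_mem _ (L.graph.smul_mem _ (L.mem_graph (w j)))

end Discrete

theorem mainTheorem4 {𝕜 : Type*} [RCLike 𝕜] {X Y : Type*}
    [NormedAddCommGroup X] [InnerProductSpace 𝕜 X] [CompleteSpace X]
    [TopologicalSpace.SeparableSpace X]
    [NormedAddCommGroup Y] [InnerProductSpace 𝕜 Y] [CompleteSpace Y]
    [TopologicalSpace.SeparableSpace Y]
    (L : X →ₗ.[𝕜] Y) (hL : IsInvertibleOperator L) :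
    -- the discrete case
    (∀ (s : ℕ) (γ : Fin s → Set.Ioi (0 : ℝ)) (w : Fin s → L.domain)
      (σ : ℕ → ℝ) (f : ℕ → WeightedSpace 𝕜 γ) (φ : ℕ → X),
      IsSingularSystem (discretePODOperator 𝕜 γ (fun j => (w j : X))) σ f φ →
      (numPositive σ < ⊤ ∨ IsBoundedOperator L ∨ IsBoundedOperator L.inverse) →
      -- error bound and convergence for `y = K^Y g`
      (∀ (g : WeightedSpace 𝕜 γ) (y : Y), y = discretePODOperator 𝕜 γ (fun j => L (w j)) g →
        Summable (fun k => σ k * ‖inner 𝕜 (f k) g‖ * ‖operatorValue L (φ k)‖) ∧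
        ∃ hy : ∀ r : ModeCount σ, y ∈ (conjugatedProjection L φ r).domain,
          (∀ r : ModeCount σ, ‖y - conjugatedProjection L φ r ⟨y, hy r⟩‖ ≤
            ∑' k : Set.Ici (r : ℕ), σ k * ‖inner 𝕜 (f k) g‖ * ‖operatorValue L (φ k)‖) ∧
          Tendsto (fun r : ModeCount σ => ‖y - conjugatedProjection L φ r ⟨y, hy r⟩‖)
            atTop (𝓝 0)) ∧
      -- convergence for all `y`
      ((numPositive σ = ⊤ → ∃ C : ℝ, ∀ (r : ModeCount σ)
          (y : (conjugatedProjection L φ r).domain),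
          ‖conjugatedProjection L φ r y‖ ≤ C * ‖(y : Y)‖) →
        AllPODEigenvaluesNonzero (discretePODOperator 𝕜 γ (fun j => L (w j))) →
        (numPositive σ < ⊤ → ∀ r : ModeCount σ, (conjugatedProjection L φ r).domain = ⊤) ∧
        ∃ E : ModeCount σ → Y →L[𝕜] Y,
          (∀ r : ModeCount σ, IsBoundedExtension (conjugatedProjection L φ r) (E r) ∧
            ∀ E', IsBoundedExtension (conjugatedProjection L φ r) E' → E' = E r) ∧
          ∀ y : Y, Tendsto (fun r => E r y) atTop (𝓝 y))) ∧
    -- the continuous case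
    (∀ (d m : ℕ) (O : Set (EuclideanSpace ℝ (Fin d))), IsOpen O →
      ∀ (w : Fin m → Lp X 2 (volume.restrict O)) (Lw : Fin m → Lp Y 2 (volume.restrict O)),
      (∀ j, ∀ᵐ t ∂(volume.restrict O), (w j t, Lw j t) ∈ L.graph) →
      (∀ h : Lp (EuclideanSpace 𝕜 (Fin m)) 2 (volume.restrict O),
        (continuousPODOperator 𝕜 w h, continuousPODOperator 𝕜 Lw h) ∈ L.graph) →
      ∀ (σ : ℕ → ℝ) (f : ℕ → Lp (EuclideanSpace 𝕜 (Fin m)) 2 (volume.restrict O))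
        (φ : ℕ → X),
      IsSingularSystem (continuousPODOperator 𝕜 w) σ f φ →
      (numPositive σ < ⊤ ∨ IsBoundedOperator L ∨ IsBoundedOperator L.inverse) →
      -- error bound and convergence for `y = K^Y g`
      (∀ (g : Lp (EuclideanSpace 𝕜 (Fin m)) 2 (volume.restrict O)) (y : Y),
        y = continuousPODOperator 𝕜 Lw g →
        Summable (fun k => σ k * ‖inner 𝕜 (f k) g‖ * ‖operatorValue L (φ k)‖) ∧
        ∃ hy : ∀ r : ModeCount σ, y ∈ (conjugatedProjection L φ r).domain,
          (∀ r : ModeCount σ, ‖y - conjugatedProjection L φ r ⟨y, hy r⟩‖ ≤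
            ∑' k : Set.Ici (r : ℕ), σ k * ‖inner 𝕜 (f k) g‖ * ‖operatorValue L (φ k)‖) ∧
          Tendsto (fun r : ModeCount σ => ‖y - conjugatedProjection L φ r ⟨y, hy r⟩‖)
            atTop (𝓝 0)) ∧
      -- convergence for all `y`
      ((numPositive σ = ⊤ → ∃ C : ℝ, ∀ (r : ModeCount σ)
          (y : (conjugatedProjection L φ r).domain),
          ‖conjugatedProjection L φ r y‖ ≤ C * ‖(y : Y)‖) →
        AllPODEigenvaluesNonzero (continuousPODOperator 𝕜 Lw) →
        (numPositive σ < ⊤ → ∀ r : ModeCount σ, (conjugatedProjection L φ r).domain = ⊤) ∧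
        ∃ E : ModeCount σ → Y →L[𝕜] Y,
          (∀ r : ModeCount σ, IsBoundedExtension (conjugatedProjection L φ r) (E r) ∧
            ∀ E', IsBoundedExtension (conjugatedProjection L φ r) E' → E' = E r) ∧
          ∀ y : Y, Tendsto (fun r => E r y) atTop (𝓝 y))) := by
  refine ⟨fun s γ w σ f φ h _ => ?_, fun d m O _ w Lw _ hKA σ f φ h _ => ?_⟩
  · have hKA := discretePODOperator_mem_graph γ L w
    -- An orthonormal family in the finite-dimensional space `𝕜^s` is finite, so summability is
    -- trivial.
    have : Finite {k : ℕ // 0 < σ k} := h.orthonormal_right.linearIndependent.finite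
    have hA : Summable fun k : {k : ℕ // 0 < σ k} =>
        ‖discretePODOperator 𝕜 γ (fun j => L (w j)) (f k)‖ ^ 2 := Summable.of_finite
    exact ⟨h.error_bound_and_tendsto hL hKA hA, h.exists_extension_tendsto hL hKA hA⟩
  · have hA := summable_norm_sq_continuousPODOperator Lw h.orthonormal_right
    exact ⟨h.error_bound_and_tendsto hL hKA hA, h.exists_extension_tendsto hL hKA hA⟩
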